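/- For real $\theta,\phi,\eta$ let $$U_{\theta,\phi}=\begin{bmatrix}\cos\theta&-ie^{i\phi}\sin\theta\\-ie^{-i\phi}\sin\theta&\cos\theta\end{bmatrix},\qquad Q_\eta=\operatorname{diag}(1,1,1,e^{i\eta}),$$ written in the bases $|0\rangle,|1\rangle$ of $\mathbb C^2$ and $|00\rangle,|01\rangle,|10\rangle,|11\rangle$ of $\mathbb C^2\otimes\mathbb C^2$. A $k$-bit gate is a unitary operator on $(\mathbb C^2)^{\otimes k}$. For a 1-bit gate $A$ and a 2-bit gate $B$, let $A(j)$ and $B(j,k)$ ($j\neq k$) be the operators on $(\mathbb C^2)^{\otimes n}$ that act as $A$ on the $j$-th factor, respectively as $B$ on the $j$-th and $k$-th factors (in this order), and as the identity on the remaining factors. A collection of 1-bit gates $A_i$ and 2-bit gates $B_j$ is called (exactly) universal if, for every $n\ge2$, every $n$-bit gate is a finite composition of operators $A_i(\ell)$ and $B_j(\ell,m)$, $1\le\ell,m\le n$, $\ell\ne m$. **Theorem 3.4.** (a) The 1-bit gates $U_{\theta,\phi}$, $0\le\theta,\phi\le2\pi$, together with the 2-bit gates $Q_\eta$, $0\le\eta\le2\pi$,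 form a universal collection. (b) In terms of the devices: let $\Omega,\hbar,g>0$ and let $\omega,\nu$ be real with $\Delta:=\nu-\omega\ne0$ and $E:=\hbar\left(-\frac{\omega}{2}+\nu+\frac{g^2}{\Delta}\right)\neq0$. Then the 1-bit gates $U_{\theta,\phi}$ with $\theta=\frac{\Omega}{2}t$, $t\ge0$, $0\le\phi\le2\pi$ (two-level atom with Rabi frequency $\Omega$, driven at resonance for a time $t$), together with the 2-bit gates $Q_\eta$ with $\eta=-\frac{E}{\hbar}t$, $t\ge0$ (cavity QED with atomic transition frequency $\omega$, cavity frequency $\nu$, coupling constant $g$ and interaction time $t$), form a universal collection. -/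

import Mathlib

noncomputable section

/-- `n`-bit operators, as matrices in the computational basis `|x₁ x₂ … xₙ⟩`, `xᵢ ∈ {0, 1}`;
a basis vector is indexed by its bit string `x : Fin n → Fin 2`. The `n`-bit gates are the
unitary ones among them. -/
abbrev NBitOp (n : ℕ) : Type := Matrix (Fin n → Fin 2) (Fin n → Fin 2) ℂ

/-- `1`-bit operators in the basis `|0⟩, |1⟩`. -/
abbrev OneBitOp : Type := Matrix (Fin 2) (Fin 2) ℂ

/-- `2`-bit operators in the basis `|00⟩, |01⟩, |10⟩, |11⟩`, where `|x y⟩` has index `(x, y)`. -/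
abbrev TwoBitOp : Type := Matrix (Fin 2 × Fin 2) (Fin 2 × Fin 2) ℂ

/-- `A(j)`: the `1`-bit operator `A` acting on slot `j` of `n` qubits, the identity elsewhere. -/
def oneBitAt {n : ℕ} (A : OneBitOp) (j : Fin n) : NBitOp n :=
  Matrix.of fun x y => if ∀ i, i ≠ j → x i = y i then A (x j) (y j) else 0

/-- `B(j, k)`: the `2`-bit operator `B` acting on slots `j` and `k` (in this order) of `n` qubits,
the identity elsewhere. It is only used for `j ≠ k`. -/
def twoBitAt {n : ℕ} (B : TwoBitOp) (j k : Fin n) : NBitOp n :=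
  Matrix.of fun x y =>
    if ∀ i, i ≠ j → i ≠ k → x i = y i then B (x j, x k) (y j, y k) else 0

/-- The elementary operations on `n` qubits offered by a collection `S` of `1`-bit gates and a
collection `T` of `2`-bit gates: the `A(j)` with `A ∈ S` and the `B(j, k)` with `B ∈ T`, `j ≠ k`. -/
def elementaryOps (S : Set OneBitOp) (T : Set TwoBitOp) (n : ℕ) : Set (NBitOp n) :=
  {M | (∃ A ∈ S, ∃ j : Fin n, M = oneBitAt A j) ∨
    (∃ B ∈ T, ∃ j k : Fin n, j ≠ k ∧ M = twoBitAt B j k)}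

/-- A collection of `1`-bit gates `S` and `2`-bit gates `T` (all unitary) is (exactly) universal
if, for each `n ≥ 2`, every `n`-bit gate is a finite composition of gates `A(j)`, `A ∈ S`, and
`B(j, k)`, `B ∈ T`. -/
def IsUniversalGateSet (S : Set OneBitOp) (T : Set TwoBitOp) : Prop :=
  (∀ A ∈ S, A ∈ Matrix.unitaryGroup (Fin 2) ℂ) ∧
  (∀ B ∈ T, B ∈ Matrix.unitaryGroup (Fin 2 × Fin 2) ℂ) ∧
  ∀ n : ℕ, 2 ≤ n → ∀ W ∈ Matrix.unitaryGroup (Fin n → Fin 2) ℂ,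
    ∃ L : List (NBitOp n), (∀ M ∈ L, M ∈ elementaryOps S T n) ∧ L.prod = W

/-- The `1`-bit unitary rotation gate `U_{θ, φ}`. -/
def rotationGate (θ φ : ℝ) : OneBitOp :=
  !![(Real.cos θ : ℂ), -Complex.I * Complex.exp (Complex.I * φ) * Real.sin θ;
     -Complex.I * Complex.exp (-(Complex.I * φ)) * Real.sin θ, (Real.cos θ : ℂ)]

/-- The `2`-bit quantum phase gate `Q_η = diag(1, 1, 1, e^{iη})`. -/
def phaseGate (η : ℝ) : TwoBitOp :=
  Matrix.diagonal fun x => if x = (1, 1) then Complex.exp (Complex.I * η) else 1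

/-- The energy level `E₋₍₁₎ = ħ (-ω/2 + ν + g²/Δ)` of the state `|1, 1⟩` of atom and cavity in the
dispersive regime: `ω` is the atomic transition frequency, `ν` the cavity frequency,
`Δ = ν - ω` the detuning, `g` the coupling constant. -/
def cavityEnergy (ħ ω ν g : ℝ) : ℝ :=
  ħ * (-(ω / 2) + ν + g ^ 2 / (ν - ω))

/-- The gates produced by a resonantly driven two-level atom with Rabi frequency `Ω`:
interaction for a time `t ≥ 0` gives the rotation with `θ = Ω t / 2`, and the phase `φ` is free. -/
def twoLevelAtomGates (Ω : ℝ) : Set OneBitOp :=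
  {A | ∃ t φ : ℝ, 0 ≤ t ∧ 0 ≤ φ ∧ φ ≤ 2 * Real.pi ∧ A = rotationGate (Ω / 2 * t) φ}

/-- The gates produced by the atom-cavity interaction: interaction for a time `t ≥ 0` gives the
phase gate with `η = -E₋₍₁₎ t / ħ`. -/
def cavityGates (ħ ω ν g : ℝ) : Set TwoBitOp :=
  {B | ∃ t : ℝ, 0 ≤ t ∧ B = phaseGate (-(cavityEnergy ħ ω ν g / ħ) * t)}

end

open Matrix

/-! All gates depend only on angles modulo 2π, and the nonnegative multiples of a nonzero constant
reach every residue, so both parts reduce to universality with unrestricted real angles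
(`isUniversalGateSet_rotation_phase`).

For that, diagonal unitaries come first. The real functions f for which every exp(itf) can be
composed form a vector space, because diagonal operators commute, and this space is stable under
substituting a controlled-not into f. It contains the products of two bits, and parity identities
then yield all monomials in the bits, hence all functions (`diagonalHamiltonians_eq_top`).

Conjugating diagonal operators by a rotation gives rotations of one bit whose angle depends on the
other bits. These clear a vector bit by bit down to a multiple of |0…0⟩ (`exists_mulVec_eq_single`).
So every unitary complex reflection is conjugate to a diagonal gate (`reflection_mem`), and
Householder reduction by such reflections turns any unitary into the identity
(`exists_mul_eq_one_on`). -/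

/-- The operators on `n` qubits composed of rotation gates and phase gates. -/
def rotationPhaseMonoid (n : ℕ) : Submonoid (NBitOp n) :=
  Submonoid.closure (elementaryOps {A | ∃ θ φ : ℝ, A = rotationGate θ φ}
    {B | ∃ η : ℝ, B = phaseGate η} n)

/-- The diagonal operator `|x⟩ ↦ exp (i f x) |x⟩`. -/
noncomputable def phaseDiagonal {n : ℕ} (f : (Fin n → Fin 2) → ℝ) : NBitOp n :=
  Matrix.diagonal fun x => Complex.exp (Complex.I * f x)

/-! ### Algebra of embedded gates -/

section embeddings

variable {n : ℕ}

theorem oneBitAt_mulVec (A : OneBitOp) (j : Fin n) (v : (Fin n → Fin 2) → ℂ)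
    (x : Fin n → Fin 2) :
    (oneBitAt A j *ᵥ v) x = ∑ b, A (x j) b * v (Function.update x j b) := by
  symm
  refine Finset.sum_of_injOn (Function.update x j) ?_ ?_ ?_ ?_
  · intro a _ b _ h
    simpa using congrFun h j
  · intro a _
    simp
  · intro y _ hy
    have h0 : ¬ ∀ i, i ≠ j → x i = y i := by
      intro h
      refine hy ⟨y j, by simp, ?_⟩
      ext i
      by_cases hi : i = j
      · subst hi; simp
      · simp [hi, h i hi]
    simp only [oneBitAt, Matrix.of_apply, if_neg h0, zero_mul]
  · intro b _
    have h0 : ∀ i, i ≠ j → x i = Function.update x j b i := fun i hi => by simp [hi]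
    simp only [oneBitAt, Matrix.of_apply, if_pos h0, Function.update_self]

theorem oneBitAt_mul (A B : OneBitOp) (j : Fin n) :
    oneBitAt (A * B) j = oneBitAt A j * oneBitAt B j := by
  refine Matrix.mulVec_injective (funext fun v => funext fun x => ?_)
  rw [← Matrix.mulVec_mulVec]
  simp only [oneBitAt_mulVec, Matrix.mul_apply, Finset.sum_mul, Finset.mul_sum,
    Function.update_self, Function.update_idem]
  rw [Finset.sum_comm]
  simp only [mul_assoc]

theorem oneBitAt_diagonal (d : Fin 2 → ℂ) (j : Fin n) :
    oneBitAt (Matrix.diagonal d) j = Matrix.diagonal fun x => d (x j) := by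
  ext x y
  rw [oneBitAt, Matrix.of_apply, Matrix.diagonal_apply, Matrix.diagonal_apply]
  by_cases h : x = y
  · subst h; simp
  · rw [if_neg h]
    split_ifs with h1 h2
    · refine absurd (funext fun i => ?_) h
      by_cases hi : i = j
      · subst hi; exact h2
      · exact h1 i hi
    · rfl
    · rfl

theorem oneBitAt_one (j : Fin n) : oneBitAt 1 j = 1 := by
  rw [← Matrix.diagonal_one, oneBitAt_diagonal, ← Matrix.diagonal_one]

theorem star_oneBitAt (A : OneBitOp) (j : Fin n) : star (oneBitAt A j) = oneBitAt (star A) j := by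
  ext x y
  simp only [oneBitAt, Matrix.star_apply, Matrix.of_apply]
  by_cases h : ∀ i, i ≠ j → x i = y i
  · rw [if_pos h, if_pos fun i hi => (h i hi).symm]
  · rw [if_neg h, if_neg fun h' => h fun i hi => (h' i hi).symm, star_zero]

theorem twoBitAt_phaseGate (η : ℝ) (j k : Fin n) :
    twoBitAt (phaseGate η) j k =
      phaseDiagonal fun x => η * (((x j : ℕ) : ℝ) * ((x k : ℕ) : ℝ)) := by
  ext x y
  rw [twoBitAt, phaseGate, phaseDiagonal, Matrix.of_apply, Matrix.diagonal_apply,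
    Matrix.diagonal_apply]
  by_cases h : x = y
  · subst h
    generalize x j = a
    generalize x k = b
    fin_cases a <;> fin_cases b <;> simp
  · rw [if_neg h]
    by_cases h1 : ∀ i, i ≠ j → i ≠ k → x i = y i
    · rw [if_pos h1, if_neg]
      intro h2
      rw [Prod.mk.injEq] at h2
      refine h (funext fun i => ?_)
      by_cases hi : i = j
      · subst hi; exact h2.1
      · by_cases hk : i = k
        · subst hk; exact h2.2
        · exact h1 i hi hk
    · rw [if_neg h1]

theorem phaseDiagonal_mulVec (f : (Fin n → Fin 2) → ℝ) (v : (Fin n → Fin 2) → ℂ)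
    (x : Fin n → Fin 2) :
    (phaseDiagonal f *ᵥ v) x = Complex.exp (Complex.I * f x) * v x := by
  rw [phaseDiagonal, Matrix.mulVec_diagonal]

theorem phaseDiagonal_add (f g : (Fin n → Fin 2) → ℝ) :
    phaseDiagonal (f + g) = phaseDiagonal f * phaseDiagonal g := by
  rw [phaseDiagonal, phaseDiagonal, phaseDiagonal, Matrix.diagonal_mul_diagonal]
  congr 1
  ext x
  rw [← Complex.exp_add, Pi.add_apply, Complex.ofReal_add, mul_add]

theorem phaseDiagonal_zero : phaseDiagonal (0 : (Fin n → Fin 2) → ℝ) = 1 := by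
  simp [phaseDiagonal]

theorem star_phaseDiagonal (f : (Fin n → Fin 2) → ℝ) :
    star (phaseDiagonal f) = phaseDiagonal (-f) := by
  rw [phaseDiagonal, phaseDiagonal, Matrix.star_eq_conjTranspose, Matrix.diagonal_conjTranspose]
  congr 1
  ext x
  simp [← Complex.exp_conj]

theorem star_rotationGate (θ φ : ℝ) : star (rotationGate θ φ) = rotationGate (-θ) φ := by
  ext a b
  fin_cases a <;> fin_cases b <;>
    simp [rotationGate, Matrix.star_apply, ← Complex.exp_conj, ← Complex.cos_conj,
      ← Complex.sin_conj]

theorem rotationGate_mul_star (θ φ : ℝ) : rotationGate θ φ * star (rotationGate θ φ) = 1 := by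
  have h : Complex.exp (Complex.I * φ) * Complex.exp (-(Complex.I * φ)) = 1 := by
    rw [← Complex.exp_add]; simp
  have h2 := Complex.cos_sq_add_sin_sq (θ : ℂ)
  rw [star_rotationGate]
  ext a b
  fin_cases a <;> fin_cases b <;> simp [rotationGate, Matrix.mul_apply]
  · linear_combination h2 + (-(Complex.I ^ 2) * Complex.sin θ ^ 2 * h) - Complex.sin θ ^ 2 * Complex.I_sq
  · ring
  · ring
  · linear_combination h2 + (-(Complex.I ^ 2) * Complex.sin θ ^ 2 * h) - Complex.sin θ ^ 2 * Complex.I_sq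

theorem rotationGate_mem_unitaryGroup (θ φ : ℝ) :
    rotationGate θ φ ∈ Matrix.unitaryGroup (Fin 2) ℂ :=
  Matrix.mem_unitaryGroup_iff.2 (rotationGate_mul_star θ φ)

theorem phaseGate_mem_unitaryGroup (η : ℝ) :
    phaseGate η ∈ Matrix.unitaryGroup (Fin 2 × Fin 2) ℂ := by
  rw [Matrix.mem_unitaryGroup_iff, phaseGate, Matrix.star_eq_conjTranspose,
    Matrix.diagonal_conjTranspose, Matrix.diagonal_mul_diagonal, ← Matrix.diagonal_one]
  congr 1
  ext x
  by_cases h : x = (1, 1)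
  · simp [h, ← Complex.exp_conj, ← Complex.exp_add]
  · simp [h]

end embeddings

/-! ### Generators and adjoints -/

namespace rotationPhaseMonoid

variable {n : ℕ}

theorem rotationGate_mem (θ φ : ℝ) (j : Fin n) :
    oneBitAt (rotationGate θ φ) j ∈ rotationPhaseMonoid n :=
  Submonoid.subset_closure (Or.inl ⟨_, ⟨θ, φ, rfl⟩, j, rfl⟩)

theorem controlledPhase_mem (η : ℝ) {j k : Fin n} (hjk : j ≠ k) :
    phaseDiagonal (fun x => η * (((x j : ℕ) : ℝ) * ((x k : ℕ) : ℝ))) ∈ rotationPhaseMonoid n := by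
  rw [← twoBitAt_phaseGate η j k]
  exact Submonoid.subset_closure (Or.inr ⟨_, ⟨η, rfl⟩, j, k, hjk, rfl⟩)

/-- The adjoint of a generator is the generator with θ or η negated, so the monoid is in fact a
group of unitaries. -/
theorem star_mem {M : NBitOp n} (hM : M ∈ rotationPhaseMonoid n) :
    star M ∈ rotationPhaseMonoid n := by
  induction hM using Submonoid.closure_induction with
  | mem M hM =>
    rcases hM with ⟨_, ⟨θ, φ, rfl⟩, j, rfl⟩ | ⟨_, ⟨η, rfl⟩, j, k, hjk, rfl⟩
    · rw [star_oneBitAt, star_rotationGate]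
      exact rotationGate_mem _ _ _
    · rw [twoBitAt_phaseGate η j k, star_phaseDiagonal]
      convert controlledPhase_mem (-η) hjk using 2
      ext x
      simp
  | one => rw [star_one]; exact one_mem _
  | mul x y _ _ hx hy => rw [star_mul]; exact mul_mem hy hx

theorem mul_star_self {M : NBitOp n} (hM : M ∈ rotationPhaseMonoid n) : M * star M = 1 := by
  induction hM using Submonoid.closure_induction with
  | mem M hM =>
    rcases hM with ⟨_, ⟨θ, φ, rfl⟩, j, rfl⟩ | ⟨_, ⟨η, rfl⟩, j, k, hjk, rfl⟩
    · rw [star_oneBitAt, ← oneBitAt_mul, rotationGate_mul_star, oneBitAt_one]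
    · rw [twoBitAt_phaseGate η j k, star_phaseDiagonal, ← phaseDiagonal_add, add_neg_cancel,
        phaseDiagonal_zero]
  | one => simp
  | mul x y _ _ hx hy =>
    rw [star_mul, mul_assoc, ← mul_assoc y, hy, one_mul, hx]

theorem star_mul_self {M : NBitOp n} (hM : M ∈ rotationPhaseMonoid n) : star M * M = 1 := by
  simpa using mul_star_self (star_mem hM)

/-! ### Diagonal gates -/

/-- The Hamiltonians diagonal in the computational basis whose evolutions are composed of
rotation gates and phase gates. -/
noncomputable def diagonalHamiltonians (n : ℕ) : Submodule ℝ ((Fin n → Fin 2) → ℝ) where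
  carrier := {f | ∀ t : ℝ, phaseDiagonal (t • f) ∈ rotationPhaseMonoid n}
  add_mem' := fun {f g} hf hg t => by
    rw [smul_add, phaseDiagonal_add]
    exact mul_mem (hf t) (hg t)
  zero_mem' := fun t => by
    rw [smul_zero, phaseDiagonal_zero]
    exact one_mem _
  smul_mem' := fun c f hf t => by
    rw [smul_smul]
    exact hf _

/-- The controlled-not map on bit strings, with control `j` and target `k`. -/
def controlledNot (j k : Fin n) (x : Fin n → Fin 2) : Fin n → Fin 2 :=
  Function.update x k (x k + x j)

/-- With η = π the phase gate is a controlled Z. The real rotation U_{π/4, -π/2} on the target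
conjugates Z to X. -/
theorem exists_controlledNot {j k : Fin n} (hjk : j ≠ k) :
    ∃ C ∈ rotationPhaseMonoid n, ∀ v x, (C *ᵥ v) x = v (controlledNot j k x) := by
  refine ⟨_, mul_mem (mul_mem (rotationGate_mem (Real.pi / 4) (-(Real.pi / 2)) k)
    (controlledPhase_mem Real.pi hjk))
    (star_mem (rotationGate_mem (Real.pi / 4) (-(Real.pi / 2)) k)), fun v x => ?_⟩
  have hR : rotationGate (Real.pi / 4) (-(Real.pi / 2)) =
      ((Real.sqrt 2 / 2 : ℝ) : ℂ) • !![1, -1; 1, 1] := by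
    have h1 : Complex.exp (Complex.I * ((-(Real.pi / 2) : ℝ) : ℂ)) = -Complex.I := by
      rw [← Complex.exp_neg_pi_div_two_mul_I]; congr 1; push_cast; ring_nf
    have h2 : Complex.exp (-(Complex.I * ((-(Real.pi / 2) : ℝ) : ℂ))) = Complex.I := by
      refine Eq.trans ?_ Complex.exp_pi_div_two_mul_I
      congr 1
      push_cast
      ring
    rw [rotationGate, h1, h2, Real.cos_pi_div_four, Real.sin_pi_div_four]
    ext a b
    fin_cases a <;> fin_cases b <;> simp
  have hs : ((Real.sqrt 2 / 2 : ℝ) : ℂ) * ((Real.sqrt 2 / 2 : ℝ) : ℂ) = 1 / 2 := by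
    rw [← Complex.ofReal_mul]
    have : Real.sqrt 2 / 2 * (Real.sqrt 2 / 2) = 1 / 2 := by
      nlinarith [Real.mul_self_sqrt (show (0 : ℝ) ≤ 2 by norm_num)]
    rw [this]; simp
  have hpi : Complex.exp (Complex.I * Real.pi) = -1 := by
    rw [mul_comm, Complex.exp_pi_mul_I]
  rw [← Matrix.mulVec_mulVec, ← Matrix.mulVec_mulVec, star_oneBitAt, hR]
  simp only [oneBitAt_mulVec, phaseDiagonal_mulVec, controlledNot, Fin.sum_univ_two,
    Function.update_idem, Function.update_self, Function.update_of_ne hjk, star_smul,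
    Matrix.smul_apply, Matrix.star_apply, RCLike.star_def, Complex.conj_ofReal]
  generalize ((Real.sqrt 2 / 2 : ℝ) : ℂ) = s at hs
  generalize x j = a
  generalize x k = b
  generalize Function.update x k = w
  fin_cases a <;> fin_cases b <;> simp [hpi]
  · linear_combination 2 * v (w 0) * hs
  · linear_combination 2 * v (w 1) * hs
  · linear_combination 2 * v (w 1) * hs
  · linear_combination 2 * v (w 0) * hs

/-- Conjugating a diagonal operator by a permutation of the basis permutes its diagonal. -/
theorem comp_controlledNot_mem {f : (Fin n → Fin 2) → ℝ} (hf : f ∈ diagonalHamiltonians n)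
    {j k : Fin n} (hjk : j ≠ k) : f ∘ controlledNot j k ∈ diagonalHamiltonians n := by
  obtain ⟨C, hC, hCv⟩ := exists_controlledNot hjk
  intro t
  have h : phaseDiagonal (t • (f ∘ controlledNot j k)) = C * phaseDiagonal (t • f) * star C := by
    have h1 : C * phaseDiagonal (t • f) = phaseDiagonal (t • (f ∘ controlledNot j k)) * C := by
      refine Matrix.mulVec_injective (funext fun v => funext fun x => ?_)
      rw [← Matrix.mulVec_mulVec, ← Matrix.mulVec_mulVec, hCv, phaseDiagonal_mulVec,
        phaseDiagonal_mulVec, hCv]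
      rfl
    rw [h1, mul_assoc, mul_star_self hC, mul_one]
  rw [h]
  exact mul_mem (mul_mem hC (hf t)) (star_mem hC)

theorem mul_bits_mem {j k : Fin n} (hjk : j ≠ k) :
    (fun x => ((x j : ℕ) : ℝ) * ((x k : ℕ) : ℝ)) ∈ diagonalHamiltonians n :=
  fun t => controlledPhase_mem t hjk

theorem one_sub_two_mul_bit_mem (j : Fin n) :
    (fun x => 1 - 2 * ((x j : ℕ) : ℝ)) ∈ diagonalHamiltonians n := by
  intro t
  have h : phaseDiagonal (t • fun x : Fin n → Fin 2 => 1 - 2 * ((x j : ℕ) : ℝ)) =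
      oneBitAt (rotationGate (Real.pi / 2) t) j * oneBitAt (rotationGate (-(Real.pi / 2)) 0) j := by
    rw [← oneBitAt_mul]
    -- At θ = ±π/2 the gates are antidiagonal, so their product is diagonal, namely diag(e^{it},
    -- e^{-it}).
    have : rotationGate (Real.pi / 2) t * rotationGate (-(Real.pi / 2)) 0 = Matrix.diagonal
        fun a : Fin 2 => Complex.exp (Complex.I * ((t * (1 - 2 * ((a : ℕ) : ℝ)) : ℝ) : ℂ)) := by
      ext a b
      fin_cases a <;> fin_cases b <;> simp [rotationGate, Matrix.mul_apply]
      · linear_combination -Complex.exp (Complex.I * t) * Complex.I_sq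
      · have h : Complex.I * ((t : ℂ) * (1 - 2)) = -(Complex.I * t) := by ring
        rw [h]
        linear_combination -Complex.exp (-(Complex.I * t)) * Complex.I_sq
    rw [this, oneBitAt_diagonal]
    rfl
  rw [h]
  exact mul_mem (rotationGate_mem _ _ _) (rotationGate_mem _ _ _)

/-- With a second bit b available, a = a(a ⊕ b) + ab. -/
theorem bit_mem (hn : 2 ≤ n) (j : Fin n) :
    (fun x => ((x j : ℕ) : ℝ)) ∈ diagonalHamiltonians n := by
  have : Nontrivial (Fin n) := Fin.nontrivial_iff_two_le.2 hn
  obtain ⟨k, hk⟩ := exists_ne j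
  convert add_mem (comp_controlledNot_mem (mul_bits_mem hk.symm) hk.symm)
    (mul_bits_mem hk.symm) using 1
  ext x
  simp only [Pi.add_apply, Function.comp_apply, controlledNot, Function.update_self,
    Function.update_of_ne hk.symm]
  generalize x j = a
  generalize x k = b
  fin_cases a <;> fin_cases b <;> simp

theorem one_mem_diagonalHamiltonians (hn : 2 ≤ n) : 1 ∈ diagonalHamiltonians n := by
  convert add_mem (one_sub_two_mul_bit_mem (⟨0, by omega⟩ : Fin n))
    (Submodule.smul_mem _ (2 : ℝ) (bit_mem hn ⟨0, by omega⟩)) using 1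
  ext x
  simp

/-- The identity ab = (a + b - (a ⊕ b))/2, multiplied by the product of the remaining bits, lowers
the degree by one. -/
theorem prod_bits_mem (hn : 2 ≤ n) (S : Finset (Fin n)) :
    (fun x => ∏ i ∈ S, ((x i : ℕ) : ℝ)) ∈ diagonalHamiltonians n := by
  induction S using Finset.strongInduction with
  | H T ih =>
    by_cases hT : 1 < T.card
    · obtain ⟨j, hj, k, hk, hjk⟩ := Finset.one_lt_card.1 hT
      have h1 := ih _ (Finset.erase_ssubset hj)
      have h2 := ih _ (Finset.erase_ssubset hk)
      convert Submodule.smul_mem _ (1 / 2 : ℝ)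
        (sub_mem (add_mem h1 h2) (comp_controlledNot_mem h1 hjk)) using 1
      ext x
      have hk' : k ∈ T.erase j := Finset.mem_erase.2 ⟨hjk.symm, hk⟩
      have hj' : j ∈ T.erase k := Finset.mem_erase.2 ⟨hjk, hj⟩
      simp only [Pi.smul_apply, Pi.sub_apply, Pi.add_apply, Function.comp_apply, smul_eq_mul]
      rw [← Finset.mul_prod_erase _ _ hj, ← Finset.mul_prod_erase _ _ hk',
        ← Finset.mul_prod_erase _ _ hk', ← Finset.mul_prod_erase _ _ hj',
        Finset.erase_right_comm (a := k)]
      have h3 : ∏ i ∈ (T.erase j).erase k, ((controlledNot j k x i : ℕ) : ℝ) =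
          ∏ i ∈ (T.erase j).erase k, ((x i : ℕ) : ℝ) := by
        refine Finset.prod_congr rfl fun i hi => ?_
        rw [controlledNot, Function.update_of_ne (Finset.ne_of_mem_erase hi)]
      rw [h3]
      generalize ∏ i ∈ (T.erase j).erase k, ((x i : ℕ) : ℝ) = p
      rw [controlledNot, Function.update_self]
      generalize x j = a
      generalize x k = b
      fin_cases a <;> fin_cases b <;> simp
      ring
    · have : Nonempty (Fin n) := ⟨⟨0, by omega⟩⟩
      obtain ⟨j, hj⟩ := Finset.card_le_one_iff_subset_singleton.1 (not_lt.1 hT)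
      rcases Finset.subset_singleton_iff.1 hj with rfl | rfl
      · exact one_mem_diagonalHamiltonians hn
      · simpa using bit_mem hn j

/-- Expanding one factor 1 - x_a at a time leaves only monomials. When S and T partition the bits,
the product is the indicator of a single bit string. -/
theorem prod_bits_mul_prod_one_sub_bits_mem (hn : 2 ≤ n) (S T : Finset (Fin n))
    (hST : Disjoint S T) :
    (fun x => (∏ i ∈ S, ((x i : ℕ) : ℝ)) * ∏ i ∈ T, (1 - ((x i : ℕ) : ℝ))) ∈
      diagonalHamiltonians n := by
  induction T using Finset.induction_on generalizing S with
  | empty => simpa using prod_bits_mem hn S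
  | insert a T ha ih =>
    have haS : a ∉ S := fun h => Finset.disjoint_left.1 hST h (Finset.mem_insert_self _ _)
    have hS : Disjoint S T := hST.mono_right (Finset.subset_insert _ _)
    convert sub_mem (ih S hS) (ih (insert a S) (Finset.disjoint_insert_left.2 ⟨ha, hS⟩)) using 1
    ext x
    simp only [Pi.sub_apply]
    rw [Finset.prod_insert ha, Finset.prod_insert haS]
    ring

theorem diagonalHamiltonians_eq_top (hn : 2 ≤ n) : diagonalHamiltonians n = ⊤ := by
  rw [eq_top_iff, ← (Pi.basisFun ℝ (Fin n → Fin 2)).span_eq, Submodule.span_le]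
  rintro _ ⟨y, rfl⟩
  have hy := prod_bits_mul_prod_one_sub_bits_mem hn (Finset.univ.filter fun i => y i = 1)
    (Finset.univ.filter fun i => ¬ y i = 1) (Finset.disjoint_filter_filter_not _ _ _)
  refine SetLike.mem_coe.2 ?_
  convert hy using 1
  ext x
  rw [Pi.basisFun_apply, Pi.single_apply]
  by_cases h : x = y
  · subst h
    rw [if_pos rfl, Finset.prod_eq_one, Finset.prod_eq_one, mul_one]
    · intro i hi
      have : x i = 0 := by
        have := (Finset.mem_filter.1 hi).2
        omega
      simp [this]
    · intro i hi
      simp [(Finset.mem_filter.1 hi).2]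
  · rw [if_neg h]
    obtain ⟨i, hi⟩ := Function.ne_iff.1 h
    by_cases hy : y i = 1
    · rw [Finset.prod_eq_zero (Finset.mem_filter.2 ⟨Finset.mem_univ i, hy⟩), zero_mul]
      have : x i = 0 := by omega
      simp [this]
    · rw [Finset.prod_eq_zero (s := Finset.univ.filter fun i => ¬ y i = 1)
        (Finset.mem_filter.2 ⟨Finset.mem_univ i, hy⟩), mul_zero]
      have : x i = 1 := by omega
      simp [this]

theorem phaseDiagonal_mem (hn : 2 ≤ n) (f : (Fin n → Fin 2) → ℝ) :
    phaseDiagonal f ∈ rotationPhaseMonoid n := by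
  have h : f ∈ diagonalHamiltonians n := by
    rw [diagonalHamiltonians_eq_top hn]; trivial
  simpa using h 1

/-! ### Reducing a vector to one basis state -/

/-- On each pair of strings differing in bit j the angle is constant, so there the diagonal gate is
diag(e^{it}, e^{-it}). Conjugation by U_{π/4, 0} makes it a real rotation by t. -/
theorem exists_multiplexedRotation (hn : 2 ≤ n) (j : Fin n) (t : (Fin n → Fin 2) → ℝ)
    (ht : ∀ x b, t (Function.update x j b) = t x) :
    ∃ M ∈ rotationPhaseMonoid n, ∀ v x, (M *ᵥ v) x =
      if x j = 0 then Real.cos (t x) * v (Function.update x j 0) -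
          Real.sin (t x) * v (Function.update x j 1)
      else Real.sin (t x) * v (Function.update x j 0) +
          Real.cos (t x) * v (Function.update x j 1) := by
  refine ⟨_, mul_mem (mul_mem (rotationGate_mem (Real.pi / 4) 0 j)
    (phaseDiagonal_mem hn fun x => t x * (1 - 2 * ((x j : ℕ) : ℝ))))
    (star_mem (rotationGate_mem (Real.pi / 4) 0 j)), fun v x => ?_⟩
  have hR : rotationGate (Real.pi / 4) 0 =
      ((Real.sqrt 2 / 2 : ℝ) : ℂ) • !![1, -Complex.I; -Complex.I, 1] := by
    rw [rotationGate, Real.cos_pi_div_four, Real.sin_pi_div_four]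
    ext a b
    fin_cases a <;> fin_cases b <;> simp <;> ring
  have hs : ((Real.sqrt 2 / 2 : ℝ) : ℂ) * ((Real.sqrt 2 / 2 : ℝ) : ℂ) = 1 / 2 := by
    rw [← Complex.ofReal_mul]
    have : Real.sqrt 2 / 2 * (Real.sqrt 2 / 2) = 1 / 2 := by
      nlinarith [Real.mul_self_sqrt (show (0 : ℝ) ≤ 2 by norm_num)]
    rw [this]; simp
  have he1 : Complex.exp (Complex.I * t x) =
      Complex.cos (t x) + Complex.sin (t x) * Complex.I := by
    rw [mul_comm, Complex.exp_mul_I]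
  have he2 : Complex.exp (Complex.I * (t x * (1 - 2))) =
      Complex.cos (t x) - Complex.sin (t x) * Complex.I := by
    rw [show Complex.I * ((t x : ℂ) * (1 - 2)) = (-t x : ℂ) * Complex.I by ring,
      Complex.exp_mul_I, Complex.cos_neg, Complex.sin_neg]
    ring
  rw [← Matrix.mulVec_mulVec, ← Matrix.mulVec_mulVec, star_oneBitAt, hR]
  simp only [oneBitAt_mulVec, phaseDiagonal_mulVec, Fin.sum_univ_two, ht,
    Function.update_idem, Function.update_self, star_smul,
    Matrix.smul_apply, Matrix.star_apply, RCLike.star_def, Complex.conj_ofReal]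
  generalize ((Real.sqrt 2 / 2 : ℝ) : ℂ) = s at hs
  generalize x j = a
  generalize Function.update x j = w
  generalize v (w 0) = p
  generalize v (w 1) = q
  fin_cases a <;> simp [he1, he2]
  all_goals generalize Complex.cos (t x) = c
  all_goals generalize Complex.sin (t x) = d
  all_goals have hI := Complex.I_sq
  · linear_combination 2 * (c * p - d * q) * hs +
      s ^ 2 * (-(c * p) + d * Complex.I * p + 2 * d * q) * hI
  · linear_combination 2 * (d * p + c * q) * hs +
      s ^ 2 * (-(Complex.I * d * q) - c * q - 2 * d * p) * hI

/-- A diagonal gate makes all amplitudes nonnegative, then each pair (p, q) is rotated by -arg(p +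
iq) onto its first axis. The second clause says that zero pairs stay zero, which preserves the bits
already cleared. -/
theorem exists_mulVec_eq_zero_of_bit (hn : 2 ≤ n) (j : Fin n) (v : (Fin n → Fin 2) → ℂ) :
    ∃ M ∈ rotationPhaseMonoid n, ∀ x, (x j = 1 → (M *ᵥ v) x = 0) ∧
      (v (Function.update x j 0) = 0 → v (Function.update x j 1) = 0 → (M *ᵥ v) x = 0) := by
  let z : (Fin n → Fin 2) → ℂ := fun x =>
    ⟨‖v (Function.update x j 0)‖, ‖v (Function.update x j 1)‖⟩
  obtain ⟨M, hM, hMv⟩ := exists_multiplexedRotation hn j (fun x => -(z x).arg)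
    (fun x b => by simp only [z, Function.update_idem])
  refine ⟨_, mul_mem hM (phaseDiagonal_mem hn fun x => -(v x).arg), fun x => ?_⟩
  have hD : ∀ y, (phaseDiagonal (fun x => -(v x).arg) *ᵥ v) y = ‖v y‖ := fun y => by
    rw [phaseDiagonal_mulVec]
    nth_rw 2 [← Complex.norm_mul_exp_arg_mul_I (v y)]
    rw [mul_left_comm, ← Complex.exp_add]
    simp [mul_comm]
  rw [← Matrix.mulVec_mulVec, hMv, hD, hD]
  constructor
  · intro hx
    have h0 : ‖v (Function.update x j 0)‖ = ‖z x‖ * Real.cos (z x).arg :=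
      (Complex.norm_mul_cos_arg (z x)).symm
    have h1 : ‖v (Function.update x j 1)‖ = ‖z x‖ * Real.sin (z x).arg :=
      (Complex.norm_mul_sin_arg (z x)).symm
    rw [if_neg (by simp [hx]), h0, h1, Real.sin_neg, Real.cos_neg]
    push_cast
    ring
  · intro h0 h1
    simp [h0, h1]

theorem exists_mulVec_eq_zero_of_bits (hn : 2 ≤ n) (S : Finset (Fin n))
    (v : (Fin n → Fin 2) → ℂ) :
    ∃ M ∈ rotationPhaseMonoid n, ∀ x, (∃ i ∈ S, x i = 1) → (M *ᵥ v) x = 0 := by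
  induction S using Finset.induction_on with
  | empty => exact ⟨1, one_mem _, by simp⟩
  | insert j S hj ih =>
    obtain ⟨M, hM, hMv⟩ := ih
    obtain ⟨N, hN, hNv⟩ := exists_mulVec_eq_zero_of_bit hn j (M *ᵥ v)
    refine ⟨N * M, mul_mem hN hM, ?_⟩
    rintro x ⟨i, hi, hx⟩
    rw [← Matrix.mulVec_mulVec]
    rcases Finset.mem_insert.1 hi with rfl | hi
    · exact (hNv x).1 hx
    · have hij : i ≠ j := fun h => hj (h ▸ hi)
      exact (hNv x).2 (hMv _ ⟨i, hi, by rw [Function.update_of_ne hij, hx]⟩)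
        (hMv _ ⟨i, hi, by rw [Function.update_of_ne hij, hx]⟩)

theorem exists_mulVec_eq_single (hn : 2 ≤ n) (v : (Fin n → Fin 2) → ℂ) :
    ∃ M ∈ rotationPhaseMonoid n, ∃ c : ℂ, M *ᵥ v = Pi.single 0 c := by
  obtain ⟨M, hM, hMv⟩ := exists_mulVec_eq_zero_of_bits hn Finset.univ v
  refine ⟨M, hM, (M *ᵥ v) 0, funext fun x => ?_⟩
  by_cases hx : x = 0
  · subst hx; simp
  · rw [Pi.single_eq_of_ne hx]
    obtain ⟨i, hi⟩ := Function.ne_iff.1 hx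
    refine hMv x ⟨i, Finset.mem_univ i, ?_⟩
    rw [Pi.zero_apply] at hi
    omega

/-! ### Reflections and Householder reduction -/

/-- Complex reflections are composed of rotation gates and phase gates. -/
theorem reflection_mem (hn : 2 ≤ n) (d : (Fin n → Fin 2) → ℂ) (α : ℂ)
    (h : ‖1 - α * (star d ⬝ᵥ d)‖ = 1) :
    1 - α • Matrix.vecMulVec d (star d) ∈ rotationPhaseMonoid n := by
  obtain ⟨M, hM, c, hc⟩ := exists_mulVec_eq_single hn d
  have hnorm : star d ⬝ᵥ d = star c * c := by
    have h1 : star (M *ᵥ d) ⬝ᵥ (M *ᵥ d) = star d ⬝ᵥ d := by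
      rw [Matrix.star_mulVec, ← Matrix.dotProduct_mulVec, Matrix.mulVec_mulVec,
        ← Matrix.star_eq_conjTranspose, star_mul_self hM, Matrix.one_mulVec]
    rw [← h1, hc]
    simp
  have hd : d = star M *ᵥ Pi.single 0 c := by
    rw [← hc, Matrix.mulVec_mulVec, star_mul_self hM, Matrix.one_mulVec]
  -- For d = c|0…0⟩ the reflection changes only one diagonal entry, which has modulus 1 by `h` and
  -- so is a phase.
  have hdiag : phaseDiagonal (fun x => if x = 0 then (1 - α * (star c * c)).arg else 0) =
      1 - α • Matrix.vecMulVec (Pi.single (0 : Fin n → Fin 2) c) (star (Pi.single 0 c)) := by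
    ext x y
    rw [phaseDiagonal, Matrix.diagonal_apply, Matrix.sub_apply, Matrix.one_apply,
      Matrix.smul_apply, Matrix.vecMulVec_apply, Pi.star_apply]
    by_cases hxy : x = y
    · subst hxy
      by_cases hx : x = 0
      · subst hx
        rw [hnorm] at h
        have h2 := Complex.norm_mul_exp_arg_mul_I (1 - α * (star c * c))
        rw [h, Complex.ofReal_one, one_mul, mul_comm _ Complex.I] at h2
        simp only [if_true, Pi.single_eq_same, h2, smul_eq_mul]
        ring
      · simp [hx]
    · rw [if_neg hxy, if_neg hxy]
      by_cases hx : x = 0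
      · have hy : y ≠ 0 := fun h => hxy (hx.trans h.symm)
        simp [hy]
      · simp [hx]
  have hR : 1 - α • Matrix.vecMulVec d (star d) = star M *
      phaseDiagonal (fun x => if x = 0 then (1 - α * (star c * c)).arg else 0) * M := by
    rw [hdiag, mul_sub, sub_mul, mul_one, star_mul_self hM, Matrix.mul_smul, Matrix.smul_mul,
      Matrix.mul_vecMulVec, Matrix.vecMulVec_mul, ← hd]
    congr 3
    rw [hd, Matrix.star_mulVec, Matrix.star_eq_conjTranspose, Matrix.conjTranspose_conjTranspose]
  rw [hR]
  exact mul_mem (mul_mem (star_mem hM) (phaseDiagonal_mem hn _)) hM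

open scoped ComplexOrder in
-- Take d = W e_z - e_z and α = (1 - W_zz)⁻¹. Unitarity gives d*W e_z = 1 - W_zz, so the reflection
-- sends W e_z to e_z. It fixes W e_y whenever d*W e_y = -W_zy vanishes.
theorem exists_reflection_mul (hn : 2 ≤ n) {W : NBitOp n} (hW : star W * W = 1)
    (z : Fin n → Fin 2) :
    ∃ R ∈ rotationPhaseMonoid n, (∀ x, (R * W) x z = (1 : NBitOp n) x z) ∧
      ∀ y, y ≠ z → W z y = 0 → ∀ x, (R * W) x y = W x y := by
  let d : (Fin n → Fin 2) → ℂ := fun x => W x z - (1 : NBitOp n) x z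
  have hdW : ∀ y, (star d ᵥ* W) y = (1 : NBitOp n) z y - W z y := fun y => by
    rw [← hW]
    simp only [d, Matrix.vecMul, dotProduct, Pi.star_apply, star_sub, sub_mul,
      Finset.sum_sub_distrib, Matrix.mul_apply, Matrix.star_apply]
    congr 1
    simp [Matrix.one_apply]
  have hdd : star d ⬝ᵥ d = (1 - W z z) + star (1 - W z z) := by
    have h1 : star d ⬝ᵥ d = (star d ᵥ* W) z - star (d z) := by
      have : d = W *ᵥ Pi.single z 1 - Pi.single z 1 := by
        ext x
        simp [d, Matrix.one_apply, Pi.single_apply]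
      nth_rw 2 [this]
      rw [dotProduct_sub, Matrix.dotProduct_mulVec]
      simp
    rw [h1, hdW]
    simp [d]
    ring
  by_cases hz : W z z = 1
  · have hd : d = 0 := by
      rw [← dotProduct_star_self_eq_zero, hdd, hz]
      simp
    refine ⟨1, one_mem _, fun x => ?_, fun y _ _ x => by rw [one_mul]⟩
    rw [one_mul]
    exact sub_eq_zero.1 (congrFun hd x)
  · have hz' : 1 - W z z ≠ 0 := sub_ne_zero.2 (Ne.symm hz)
    have hmul : ∀ x y, ((1 - (1 - W z z)⁻¹ • Matrix.vecMulVec d (star d)) * W) x y =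
        W x y - (1 - W z z)⁻¹ * (d x * ((1 : NBitOp n) z y - W z y)) := fun x y => by
      rw [sub_mul, one_mul, Matrix.smul_mul, Matrix.vecMulVec_mul, Matrix.sub_apply,
        Matrix.smul_apply, Matrix.vecMulVec_apply, hdW, smul_eq_mul]
    refine ⟨_, reflection_mem hn d (1 - W z z)⁻¹ ?_, fun x => ?_, fun y hy hWy x => ?_⟩
    -- Since d*d = (1 - w) + conj(1 - w) for w = W_zz, the eigenvalue is -conj(1 - w)/(1 - w), of
    -- modulus 1.
    · rw [hdd, mul_add, inv_mul_cancel₀ hz', sub_add_cancel_left, norm_neg, norm_mul, norm_inv,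
        norm_star, inv_mul_cancel₀ (norm_ne_zero_iff.2 hz')]
    · rw [hmul, Matrix.one_apply_eq]
      field_simp
      simp [d]
    · rw [hmul, hWy, Matrix.one_apply_ne hy.symm]
      simp

theorem exists_mul_eq_one_on (hn : 2 ≤ n) {W : NBitOp n} (hW : star W * W = 1)
    (s : Finset (Fin n → Fin 2)) :
    ∃ M ∈ rotationPhaseMonoid n, ∀ y ∈ s, ∀ x, (M * W) x y = (1 : NBitOp n) x y := by
  induction s using Finset.induction_on with
  | empty => exact ⟨1, one_mem _, by simp⟩
  | insert z s hz ih =>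
    obtain ⟨M, hM, hMW⟩ := ih
    have hMW' : star (M * W) * (M * W) = 1 := by
      rw [star_mul, mul_assoc, ← mul_assoc (star M), star_mul_self hM, one_mul, hW]
    obtain ⟨R, hR, hRz, hRy⟩ := exists_reflection_mul hn hMW' z
    refine ⟨R * M, mul_mem hR hM, fun y hy x => ?_⟩
    rw [mul_assoc]
    rcases Finset.mem_insert.1 hy with rfl | hy
    · exact hRz x
    · have hyz : y ≠ z := fun h => hz (h ▸ hy)
      -- A finished column is e_y, whose entry in row z is zero, so the new reflection leaves it
      -- alone.
      rw [hRy y hyz (by rw [hMW y hy, Matrix.one_apply_ne hyz.symm]), hMW y hy]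

theorem mem_of_mem_unitaryGroup (hn : 2 ≤ n) {W : NBitOp n}
    (hW : W ∈ Matrix.unitaryGroup (Fin n → Fin 2) ℂ) : W ∈ rotationPhaseMonoid n := by
  obtain ⟨M, hM, hMW⟩ := exists_mul_eq_one_on hn (Matrix.mem_unitaryGroup_iff'.1 hW) Finset.univ
  have h : M * W = 1 := Matrix.ext fun x y => hMW y (Finset.mem_univ y) x
  have h2 : W = star M := by
    rw [← one_mul W, ← star_mul_self hM, mul_assoc, h, mul_one]
  rw [h2]
  exact star_mem hM

end rotationPhaseMonoid

theorem isUniversalGateSet_rotation_phase :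
    IsUniversalGateSet {A | ∃ θ φ : ℝ, A = rotationGate θ φ} {B | ∃ η : ℝ, B = phaseGate η} := by
  refine ⟨?_, ?_, fun n hn W hW => ?_⟩
  · rintro _ ⟨θ, φ, rfl⟩
    exact rotationGate_mem_unitaryGroup θ φ
  · rintro _ ⟨η, rfl⟩
    exact phaseGate_mem_unitaryGroup η
  · exact Submonoid.exists_list_of_mem_closure (rotationPhaseMonoid.mem_of_mem_unitaryGroup hn hW)

/-! ### Angles modulo 2π and interaction times -/

theorem exp_I_mul_sub_zsmul (x : ℝ) (k : ℤ) :
    Complex.exp (Complex.I * ((x - k • (2 * Real.pi) : ℝ) : ℂ)) = Complex.exp (Complex.I * x) := by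
  have h : Complex.I * ((x - k • (2 * Real.pi) : ℝ) : ℂ) =
      Complex.I * x - k • (2 * Real.pi * Complex.I) := by
    push_cast [zsmul_eq_mul]
    ring
  rw [h, Complex.exp_periodic.sub_zsmul_eq]

theorem phaseGate_sub_zsmul (η : ℝ) (k : ℤ) :
    phaseGate (η - k • (2 * Real.pi)) = phaseGate η := by
  rw [phaseGate, phaseGate, exp_I_mul_sub_zsmul]

theorem rotationGate_sub_zsmul (θ φ : ℝ) (k l : ℤ) :
    rotationGate (θ - k • (2 * Real.pi)) (φ - l • (2 * Real.pi)) = rotationGate θ φ := by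
  rw [rotationGate, rotationGate, Complex.exp_neg, Complex.exp_neg, exp_I_mul_sub_zsmul,
    Real.cos_periodic.sub_zsmul_eq, Real.sin_periodic.sub_zsmul_eq]

theorem exists_sub_zsmul_two_pi_mem (x : ℝ) :
    ∃ k : ℤ, 0 ≤ x - k • (2 * Real.pi) ∧ x - k • (2 * Real.pi) ≤ 2 * Real.pi := by
  have h := toIcoMod_mem_Ico Real.two_pi_pos 0 x
  rw [zero_add] at h
  exact ⟨toIcoDiv Real.two_pi_pos 0 x, h.1, h.2.le⟩

theorem exists_nonneg_mul_eq_sub_zsmul {c : ℝ} (hc : c ≠ 0) (x : ℝ) :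
    ∃ t : ℝ, 0 ≤ t ∧ ∃ k : ℤ, c * t = x - k • (2 * Real.pi) := by
  obtain ⟨k, hk0, hk1⟩ := exists_sub_zsmul_two_pi_mem x
  rcases hc.lt_or_gt with hc' | hc'
  -- For negative c the numerator must be nonpositive, hence one extra period is subtracted.
  · refine ⟨(x - (k + 1) • (2 * Real.pi)) / c, div_nonneg_of_nonpos ?_ hc'.le, k + 1,
      mul_div_cancel₀ _ hc⟩
    rw [add_smul, one_smul]
    linarith
  · exact ⟨(x - k • (2 * Real.pi)) / c, div_nonneg hk0 hc'.le, k, mul_div_cancel₀ _ hc⟩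

theorem twoLevelAtomGates_eq {Ω : ℝ} (hΩ : Ω ≠ 0) :
    twoLevelAtomGates Ω = {A | ∃ θ φ : ℝ, A = rotationGate θ φ} := by
  ext A
  constructor
  · rintro ⟨t, φ, -, -, -, rfl⟩
    exact ⟨_, _, rfl⟩
  · rintro ⟨θ, φ, rfl⟩
    obtain ⟨t, ht, k, hk⟩ := exists_nonneg_mul_eq_sub_zsmul (div_ne_zero hΩ two_ne_zero) θ
    obtain ⟨l, hl0, hl1⟩ := exists_sub_zsmul_two_pi_mem φ
    exact ⟨t, _, ht, hl0, hl1, by rw [hk, rotationGate_sub_zsmul]⟩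

theorem cavityGates_eq {ħ ω ν g : ℝ} (hħ : ħ ≠ 0) (hE : cavityEnergy ħ ω ν g ≠ 0) :
    cavityGates ħ ω ν g = {B | ∃ η : ℝ, B = phaseGate η} := by
  ext B
  constructor
  · rintro ⟨t, -, rfl⟩
    exact ⟨_, rfl⟩
  · rintro ⟨η, rfl⟩
    obtain ⟨t, ht, k, hk⟩ :=
      exists_nonneg_mul_eq_sub_zsmul (neg_ne_zero.2 (div_ne_zero hE hħ)) η
    exact ⟨t, ht, by rw [hk, phaseGate_sub_zsmul]⟩

theorem theorem3p4 :
    IsUniversalGateSet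
      {A | ∃ θ φ : ℝ, 0 ≤ θ ∧ θ ≤ 2 * Real.pi ∧ 0 ≤ φ ∧ φ ≤ 2 * Real.pi ∧ A = rotationGate θ φ}
      {B | ∃ η : ℝ, 0 ≤ η ∧ η ≤ 2 * Real.pi ∧ B = phaseGate η} ∧
    ∀ Ω ħ ω ν g : ℝ, 0 < Ω → 0 < ħ → 0 < g → ν ≠ ω → cavityEnergy ħ ω ν g ≠ 0 →
      IsUniversalGateSet (twoLevelAtomGates Ω) (cavityGates ħ ω ν g) := by
  refine ⟨?_, fun Ω ħ ω ν g hΩ hħ _ _ hE => ?_⟩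
  · convert isUniversalGateSet_rotation_phase using 1
    · ext A
      constructor
      · rintro ⟨θ, φ, -, -, -, -, rfl⟩
        exact ⟨_, _, rfl⟩
      · rintro ⟨θ, φ, rfl⟩
        obtain ⟨k, hk0, hk1⟩ := exists_sub_zsmul_two_pi_mem θ
        obtain ⟨l, hl0, hl1⟩ := exists_sub_zsmul_two_pi_mem φ
        exact ⟨_, _, hk0, hk1, hl0, hl1, (rotationGate_sub_zsmul θ φ k l).symm⟩
    · ext B
      constructor
      · rintro ⟨η, -, -, rfl⟩
        exact ⟨_, rfl⟩
      · rintro ⟨η, rfl⟩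
        obtain ⟨k, hk0, hk1⟩ := exists_sub_zsmul_two_pi_mem η
        exact ⟨_, hk0, hk1, (phaseGate_sub_zsmul η k).symm⟩
  · rw [twoLevelAtomGates_eq hΩ.ne', cavityGates_eq hħ.ne' hE]
    exact isUniversalGateSet_rotation_phase
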